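/- Let $2<\beta<3$, $w_0>0$ and $\lambda>0$ be constants. For $n\ge 1$ and $d\ge 1$, the standard geometric inhomogeneous random graph (GIRG) $\mathrm{GIRG}(n,\beta,w_0,d)$ is the following random graph on $n$ vertices. Each vertex $v$ independently receives a random weight $w_v$ with the Pareto distribution $\Pr[w_v\le x]=1-(x/w_0)^{1-\beta}$ for $x\ge w_0$, and, independently of all weights, a uniformly random position $\mathbf{x}_v$ on the $d$-dimensional torus $\mathbb{T}^d=\mathbb{R}^d/\mathbb{Z}^d$. Distances on the torus are measured in the $L_\infty$-norm: $\mathrm{dist}(\mathbf{x}_u,\mathbf{x}_v)=\max_{1\le i\le d}\min\{|\mathbf{x}_{ui}-\mathbf{x}_{vi}|,\,1-|\mathbf{x}_{ui}-\mathbf{x}_{vi}|\}$ for coordinates in $[0,1)$. Two vertices $u\ne v$ are adjacent if and only if $$\mathrm{dist}(\mathbf{x}_u,\mathbf{x}_v)\le \frac12\left(\frac{\lambda w_uw_v}{n}\right)^{1/d}.$$ Let $\omega(G)$ denote the clique number of $G$, i.e. the number of vertices of a largest clique. Then $\omega(G)=O(n^{(3-\beta)/2})$ asymptotically almost surely, for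 every choice of the dimension, which may depend on $n$. That is, there is a constant $C>0$, depending only on $\beta$, $w_0$ and $\lambda$, such that for every sequence of dimensions $d=d(n)\ge 1$, the graph $G=\mathrm{GIRG}(n,\beta,w_0,d(n))$ satisfies $$\lim_{n\to\infty}\Pr\left[\omega(G)\le C\,n^{(3-\beta)/2}\right]=1.$$ -/

import Mathlib

open MeasureTheory ProbabilityTheory Filter Topology

noncomputable section

/-- The `d`-dimensional torus, a product of `d` circles of length `1`. Its metric is the maximum
over the coordinates of the distance on the circle, `min (|x - y|) (1 - |x - y|)` for
representatives in `[0, 1)`. -/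
abbrev Torus (d : ℕ) : Type := Fin d → UnitAddCircle

/-- The outcome of the random experiment: each of the `n` vertices carries a weight and a
position on the torus. -/
abbrev GIRGSample (n d : ℕ) : Type := Fin n → ℝ × Torus d

/-- The connection threshold `(1/2) * (lam * w_u * w_v / n) ^ (1 / d)`. -/
def connectionThreshold (n d : ℕ) (lam wu wv : ℝ) : ℝ :=
  (1 / 2) * (lam * wu * wv / (n : ℝ)) ^ (1 / (d : ℝ))

/-- The graph determined by weights and positions: two distinct vertices are adjacent if and only
if their distance on the torus is at most their connection threshold. -/
def girgGraph {n d : ℕ} (lam : ℝ) (ω : GIRGSample n d) : SimpleGraph (Fin n) where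
  Adj u v := u ≠ v ∧ dist (ω u).2 (ω v).2 ≤ connectionThreshold n d lam (ω u).1 (ω v).1
  symm := ⟨fun u v h => ⟨h.1.symm, by
    have h2 := h.2
    rw [dist_comm, connectionThreshold, mul_right_comm lam]
    exact h2⟩⟩
  loopless := ⟨fun _ h => h.1 rfl⟩

/-- The law of weights and positions in a standard GIRG: all weights and positions are
independent, the weights are Pareto distributed with density
`(β - 1) * w₀ ^ (β - 1) * x ^ (-β)` on `[w₀, ∞)`, and the positions are uniform on the torus. -/
def girgMeasure (n : ℕ) (β w₀ : ℝ) (d : ℕ) : Measure (GIRGSample n d) :=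
  Measure.pi fun _ => (paretoMeasure w₀ (β - 1)).prod (volume : Measure (Torus d))

end

/-! In a clique, all other vertices are neighbours of the lightest one and at least as heavy. Given
a vertex of weight `w`, another vertex is such a neighbour with probability `O(w ^ (1 - β))`, by the
Pareto tail alone, and `O(w ^ (3 - β) / n)`, by integrating the connection probability over the
heavier weights. The first bound decreases in `w`, the second increases, and they meet at `w = √n`.
So the probability is `O(n ^ ((1 - β) / 2))` uniformly in weight, position and dimension
(`exists_measure_heavierNeighborSet_le`).

Given one vertex the others are independent, so a Chernoff bound (`measure_pi_le_card_filter_le`)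
and a union bound over the possible lightest vertices finish the proof. -/

/-! ### Pareto weights and volumes on the torus -/

/-- Truncated moments of the Pareto distribution. -/
theorem setLIntegral_rpow_paretoMeasure {t r s a : ℝ} (ht : 0 < t) (hr : 0 < r) (hs : s < r)
    (ha : t ≤ a) :
    ∫⁻ x in Set.Ici a, ENNReal.ofReal (x ^ s) ∂(paretoMeasure t r) =
      ENNReal.ofReal (r * t ^ r / (r - s) * a ^ (s - r)) := by
  have ha0 : 0 < a := ht.trans_le ha
  have hpdf : Measurable (paretoPDF t r) := (measurable_paretoPDFReal t r).ennreal_ofReal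
  rw [paretoMeasure, setLIntegral_withDensity_eq_setLIntegral_mul _ hpdf (by fun_prop)
    measurableSet_Ici]
  have hcongr : ∫⁻ x in Set.Ici a, (paretoPDF t r * fun x => ENNReal.ofReal (x ^ s)) x =
      ∫⁻ x in Set.Ici a, ENNReal.ofReal (r * t ^ r * x ^ (s - r - 1)) := by
    refine setLIntegral_congr_fun measurableSet_Ici fun x (hx : a ≤ x) => ?_
    have hx0 : 0 < x := ha0.trans_le hx
    simp only [Pi.mul_apply]
    rw [paretoPDF_of_le (ha.trans hx), ← ENNReal.ofReal_mul (by positivity), mul_assoc,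
      ← Real.rpow_add hx0]
    congr 3
    ring
  have hint : IntegrableOn (fun x : ℝ => x ^ (s - r - 1)) (Set.Ioi a) :=
    integrableOn_Ioi_rpow_of_lt (by linarith) ha0
  rw [hcongr, setLIntegral_congr Ioi_ae_eq_Ici.symm,
    ← ofReal_integral_eq_lintegral_ofReal (hint.const_mul _), integral_const_mul,
    integral_Ioi_rpow_of_lt (by linarith) ha0]
  · congr 1
    have h1 : s - r - 1 + 1 = s - r := by ring
    have h2 : s - r ≠ 0 := by linarith
    have h3 : r - s ≠ 0 := by linarith
    rw [h1]
    field_simp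
    ring
  · refine (ae_restrict_iff' measurableSet_Ioi).mpr (ae_of_all _ fun x (hx : a < x) => ?_)
    have hx0 : 0 < x := ha0.trans hx
    simp only [Pi.zero_apply]
    positivity

theorem ae_le_paretoMeasure (t r : ℝ) : ∀ᵐ x ∂(paretoMeasure t r), t ≤ x := by
  rw [ae_iff]
  have h : {x | ¬t ≤ x} = Set.Iio t := by ext; simp
  rw [h, paretoMeasure, withDensity_apply _ measurableSet_Iio, lintegral_paretoPDF_of_le le_rfl]

instance UnitAddCircle.isProbabilityMeasure_volume :
    IsProbabilityMeasure (volume : Measure UnitAddCircle) :=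
  ⟨by rw [UnitAddCircle.measure_univ]⟩

theorem Torus.volume_closedBall_le (d : ℕ) (x : Torus d) {r : ℝ} (hr : 0 ≤ r) :
    volume (Metric.closedBall x r) ≤ ENNReal.ofReal ((2 * r) ^ d) := by
  rw [closedBall_pi x hr, volume_pi_pi, ENNReal.ofReal_pow (by positivity)]
  calc ∏ i, volume (Metric.closedBall (x i) r) ≤ ∏ _i : Fin d, ENNReal.ofReal (2 * r) := by
        refine Finset.prod_le_prod' fun i _ => ?_
        rw [AddCircle.volume_closedBall]
        exact ENNReal.ofReal_le_ofReal (min_le_right _ _)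
    _ = _ := by simp

/-! ### A Chernoff bound conditional on one coordinate -/

/-- Exponential tail bound for the number of coordinates `ω j`, `j ≠ i`, of an i.i.d. sequence with
`(ω i, ω j) ∈ A`. -/
theorem measure_pi_le_card_filter_le {X : Type*} [MeasurableSpace X] (ν : Measure X)
    [IsProbabilityMeasure ν] {A : Set (X × X)} (hA : MeasurableSet A) {p : ℝ} (hp : 0 ≤ p)
    (h : ∀ᵐ a ∂ν, ν {y | (a, y) ∈ A} ≤ ENNReal.ofReal p) (m : ℕ) (i : Fin (m + 1)) (t : ℝ) :
    open Classical in
    Measure.pi (fun _ : Fin (m + 1) => ν)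
      {ω | t ≤ (Finset.univ.filter fun j : Fin m => (ω i, ω (i.succAbove j)) ∈ A).card} ≤
      ENNReal.ofReal (Real.exp (m * (Real.exp 1 * p) - t)) := by
  classical
  -- This dominates `exp` of the indicator of `A`, and its mean is at most `1 + e * p ≤ exp (e *
  -- p)`.
  set g : X × X → ENNReal := fun z => 1 + A.indicator (fun _ => ENNReal.ofReal (Real.exp 1)) z
    with hg
  have hgm : Measurable g := (measurable_const.indicator hA).const_add 1
  set f : X × (Fin m → X) → ENNReal := fun z => ∏ j, g (z.1, z.2 j) with hf
  have hfm : Measurable f := by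
    refine Finset.measurable_prod _ fun j _ => hgm.comp ?_
    fun_prop
  have hgint : ∀ᵐ a ∂ν, ∫⁻ y, g (a, y) ∂ν ≤ ENNReal.ofReal (Real.exp (Real.exp 1 * p)) := by
    filter_upwards [h] with a ha
    have hAa : MeasurableSet {y | (a, y) ∈ A} := measurable_prodMk_left hA
    have h1 : ∀ y, g (a, y) =
        1 + {y | (a, y) ∈ A}.indicator (fun _ => ENNReal.ofReal (Real.exp 1)) y := fun y => by
      simp [hg, Set.indicator]
    simp_rw [h1]
    rw [lintegral_add_left measurable_const, lintegral_indicator_const hAa, lintegral_const,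
      measure_univ, mul_one]
    calc 1 + ENNReal.ofReal (Real.exp 1) * ν {y | (a, y) ∈ A}
        ≤ 1 + ENNReal.ofReal (Real.exp 1) * ENNReal.ofReal p := by gcongr
      _ = ENNReal.ofReal (1 + Real.exp 1 * p) := by
        rw [ENNReal.ofReal_add zero_le_one (by positivity), ENNReal.ofReal_mul (by positivity),
          ENNReal.ofReal_one]
      _ ≤ _ := ENNReal.ofReal_le_ofReal (by linarith [Real.add_one_le_exp (Real.exp 1 * p)])
  have hpi : ∀ a, ∫⁻ y, f (a, y) ∂(Measure.pi fun _ : Fin m => ν) = (∫⁻ y, g (a, y) ∂ν) ^ m := by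
    intro a
    have hga : Measurable fun y => g (a, y) := hgm.comp measurable_prodMk_left
    have hind := iIndepFun_pi (μ := fun _ : Fin m => ν) (X := fun _ y => g (a, y))
      fun _ => hga.aemeasurable
    simp only [hf]
    rw [lintegral_prod_eq_prod_lintegral_of_indepFun Finset.univ
      (fun (j : Fin m) (y : Fin m → X) => g (a, y j)) hind
      fun j => hga.comp (measurable_pi_apply j)]
    have h2 : ∀ j : Fin m, ∫⁻ y, g (a, y j) ∂(Measure.pi fun _ : Fin m => ν) =
        ∫⁻ y, g (a, y) ∂ν := fun j =>
      (measurePreserving_eval (fun _ : Fin m => ν) j).lintegral_comp hga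
    simp [h2]
  have hmp := measurePreserving_piFinSuccAbove (fun _ : Fin (m + 1) => ν) i
  have hint : ∫⁻ ω, f (MeasurableEquiv.piFinSuccAbove (fun _ => X) i ω)
      ∂(Measure.pi fun _ : Fin (m + 1) => ν) ≤
      ENNReal.ofReal (Real.exp (m * (Real.exp 1 * p))) := by
    rw [hmp.lintegral_comp hfm, lintegral_prod _ hfm.aemeasurable]
    simp_rw [hpi]
    calc ∫⁻ a, (∫⁻ y, g (a, y) ∂ν) ^ m ∂ν
        ≤ ∫⁻ _a, ENNReal.ofReal (Real.exp (Real.exp 1 * p)) ^ m ∂ν := by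
          refine lintegral_mono_ae ?_
          filter_upwards [hgint] with a ha
          gcongr
      _ = _ := by
        rw [lintegral_const, measure_univ, mul_one, ← ENNReal.ofReal_pow (by positivity),
          ← Real.exp_nat_mul]
  have hsub : {ω : Fin (m + 1) → X |
      t ≤ (Finset.univ.filter fun j : Fin m => (ω i, ω (i.succAbove j)) ∈ A).card} ⊆
      {ω | ENNReal.ofReal (Real.exp t) ≤ f (MeasurableEquiv.piFinSuccAbove (fun _ => X) i ω)} := by
    intro ω hω
    simp only [Set.mem_ofPred_eq] at hω ⊢
    have h3 : f (MeasurableEquiv.piFinSuccAbove (fun _ => X) i ω) =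
        ∏ j, g (ω i, ω (i.succAbove j)) := rfl
    rw [h3]
    calc ENNReal.ofReal (Real.exp t)
        ≤ ENNReal.ofReal (Real.exp 1) ^
          (Finset.univ.filter fun j : Fin m => (ω i, ω (i.succAbove j)) ∈ A).card := by
          rw [← ENNReal.ofReal_pow (by positivity), ← Real.exp_nat_mul, mul_one]
          exact ENNReal.ofReal_le_ofReal (Real.exp_le_exp.mpr hω)
      _ = ∏ j, if (ω i, ω (i.succAbove j)) ∈ A then ENNReal.ofReal (Real.exp 1) else 1 := by
          rw [← Finset.prod_filter, Finset.prod_const]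
      _ ≤ _ := by
          refine Finset.prod_le_prod' fun j _ => ?_
          by_cases hj : (ω i, ω (i.succAbove j)) ∈ A <;> simp [hg, hj]
  calc _ ≤ _ := measure_mono hsub
    _ ≤ _ := meas_ge_le_lintegral_div (hfm.comp (MeasurableEquiv.measurable _)).aemeasurable
      (by simp [Real.exp_pos]) ENNReal.ofReal_ne_top
    _ ≤ ENNReal.ofReal (Real.exp (m * (Real.exp 1 * p))) / ENNReal.ofReal (Real.exp t) := by
      exact ENNReal.div_le_div_right hint _
    _ = _ := by rw [← ENNReal.ofReal_div_of_pos (Real.exp_pos t), ← Real.exp_sub]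

/-! ### Probability of a heavier neighbour -/

/-- Pairs `(a, b)` such that a vertex with data `b` is at least as heavy as a vertex with data `a`
and close enough to it to be adjacent. -/
def heavierNeighborSet (n d : ℕ) (lam : ℝ) : Set ((ℝ × Torus d) × (ℝ × Torus d)) :=
  {z | z.1.1 ≤ z.2.1 ∧ dist z.1.2 z.2.2 ≤ connectionThreshold n d lam z.1.1 z.2.1}

theorem measurableSet_heavierNeighborSet (n d : ℕ) (lam : ℝ) :
    MeasurableSet (heavierNeighborSet n d lam) := by
  have h1 : Measurable fun z : (ℝ × Torus d) × (ℝ × Torus d) => dist z.1.2 z.2.2 := by fun_prop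
  have h2 : Measurable fun z : (ℝ × Torus d) × (ℝ × Torus d) =>
      connectionThreshold n d lam z.1.1 z.2.1 := by
    unfold connectionThreshold
    fun_prop
  exact (measurableSet_le measurable_fst.fst measurable_snd.fst).inter (measurableSet_le h1 h2)

/-- The factor `1 / 2` and the exponent `1 / d` of the threshold cancel against the ball volume `(2
* r) ^ d`, which removes the dimension from all later bounds. -/
theorem volume_dist_le_connectionThreshold_le {n d : ℕ} (hd : 1 ≤ d) {lam wu wv : ℝ}
    (h : 0 ≤ lam * wu * wv / n) (x : Torus d) :
    volume {y | dist x y ≤ connectionThreshold n d lam wu wv} ≤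
      ENNReal.ofReal (lam * wu * wv / n) := by
  have hset : {y | dist x y ≤ connectionThreshold n d lam wu wv} =
      Metric.closedBall x (connectionThreshold n d lam wu wv) := by
    ext y; simp [dist_comm]
  rw [hset]
  refine (Torus.volume_closedBall_le d x (by unfold connectionThreshold; positivity)).trans_eq ?_
  congr 1
  rw [connectionThreshold, ← mul_assoc, mul_one_div_cancel two_ne_zero, one_mul, one_div,
    Real.rpow_inv_natCast_pow h (by omega)]

/-- Positions are ignored; this is the bound used for `a.1 ≥ √n`. -/
theorem measure_heavierNeighborSet_le_tail {β w₀ lam : ℝ} (hβ : 1 < β) (hw₀ : 0 < w₀)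
    (n d : ℕ) {a : ℝ × Torus d} (ha : w₀ ≤ a.1) :
    ((paretoMeasure w₀ (β - 1)).prod (volume : Measure (Torus d)))
      {y | (a, y) ∈ heavierNeighborSet n d lam} ≤
      ENNReal.ofReal (w₀ ^ (β - 1) * a.1 ^ (1 - β)) := by
  have hβ' : 0 < β - 1 := by linarith
  have := isProbabilityMeasure_paretoMeasure hw₀ hβ'
  calc _ ≤ ((paretoMeasure w₀ (β - 1)).prod (volume : Measure (Torus d)))
        (Set.Ici a.1 ×ˢ Set.univ) := measure_mono fun y hy => ⟨hy.1, trivial⟩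
    _ = paretoMeasure w₀ (β - 1) (Set.Ici a.1) := by rw [Measure.prod_prod, measure_univ, mul_one]
    _ = _ := by
      have h := setLIntegral_rpow_paretoMeasure (s := 0) hw₀ hβ' hβ' ha
      simp only [Real.rpow_zero, ENNReal.ofReal_one, setLIntegral_one] at h
      rw [h]
      congr 1
      have : β - 1 ≠ 0 := hβ'.ne'
      rw [sub_zero, mul_div_cancel_left₀ _ this]
      congr 2
      ring

/-- The bound used for `a.1 ≤ √n`. The connection probability is linear in the heavier weight, whose
first moment is finite because `β > 2`. -/
theorem measure_heavierNeighborSet_le_moment {β w₀ lam : ℝ} (hβ : 2 < β) (hw₀ : 0 < w₀)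
    (hlam : 0 < lam) (n : ℕ) {d : ℕ} (hd : 1 ≤ d) {a : ℝ × Torus d} (ha : w₀ ≤ a.1) :
    ((paretoMeasure w₀ (β - 1)).prod (volume : Measure (Torus d)))
      {y | (a, y) ∈ heavierNeighborSet n d lam} ≤
      ENNReal.ofReal (lam * (β - 1) * w₀ ^ (β - 1) / (β - 2) * (a.1 ^ (3 - β) / n)) := by
  have hβ' : 0 < β - 1 := by linarith
  have := isProbabilityMeasure_paretoMeasure hw₀ hβ'
  have ha0 : 0 < a.1 := hw₀.trans_le ha
  have hmeas : MeasurableSet {y | (a, y) ∈ heavierNeighborSet n d lam} :=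
    measurable_prodMk_left (measurableSet_heavierNeighborSet n d lam)
  rw [Measure.prod_apply hmeas]
  calc _ ≤ ∫⁻ x, (Set.Ici a.1).indicator
          (fun x => ENNReal.ofReal (lam * a.1 / n) * ENNReal.ofReal (x ^ (1 : ℝ))) x
          ∂(paretoMeasure w₀ (β - 1)) := by
        refine lintegral_mono fun x => ?_
        by_cases hx : a.1 ≤ x
        · have hx0 : 0 < x := ha0.trans_le hx
          rw [Set.indicator_of_mem (Set.mem_Ici.mpr hx), ← ENNReal.ofReal_mul (by positivity)]
          have hsub : Prod.mk x ⁻¹' {y | (a, y) ∈ heavierNeighborSet n d lam} ⊆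
              {y | dist a.2 y ≤ connectionThreshold n d lam a.1 x} := fun y hy => hy.2
          refine (measure_mono hsub).trans
            ((volume_dist_le_connectionThreshold_le hd (by positivity) a.2).trans_eq ?_)
          congr 1
          rw [Real.rpow_one]
          ring
        · rw [Set.indicator_of_notMem (by simpa using hx)]
          refine le_of_eq (measure_mono_null (fun y hy => ?_) measure_empty)
          exact hx hy.1
    _ = _ := by
        rw [lintegral_indicator measurableSet_Ici, lintegral_const_mul _ (by fun_prop),
          setLIntegral_rpow_paretoMeasure hw₀ hβ' (by linarith) ha,
          ← ENNReal.ofReal_mul (by positivity)]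
        congr 1
        have h1 : a.1 ^ (3 - β) = a.1 * a.1 ^ (1 - (β - 1)) := by
          rw [mul_comm, ← Real.rpow_add_one ha0.ne']
          congr 1
          ring
        rw [h1, show β - 1 - 1 = β - 2 by ring]
        ring

theorem exists_measure_heavierNeighborSet_le {β w₀ lam : ℝ} (hβ₂ : 2 < β) (hβ₃ : β < 3)
    (hw₀ : 0 < w₀) (hlam : 0 < lam) :
    ∃ K : ℝ, 0 < K ∧ ∀ n d : ℕ, 1 ≤ n → 1 ≤ d → ∀ a : ℝ × Torus d, w₀ ≤ a.1 →
      ((paretoMeasure w₀ (β - 1)).prod (volume : Measure (Torus d)))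
        {y | (a, y) ∈ heavierNeighborSet n d lam} ≤
        ENNReal.ofReal (K * (n : ℝ) ^ ((1 - β) / 2)) := by
  have hβ1 : 0 < β - 1 := by linarith
  have hβ2 : 0 < β - 2 := by linarith
  set K₁ := lam * (β - 1) * w₀ ^ (β - 1) / (β - 2) with hK₁
  set K₂ := w₀ ^ (β - 1) with hK₂
  have hK₁pos : 0 < K₁ := by positivity
  have hK₂pos : 0 < K₂ := by positivity
  refine ⟨K₁ + K₂, by positivity, fun n d hn hd a ha => ?_⟩
  have hn0 : (0 : ℝ) < n := by exact_mod_cast hn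
  have ha0 : 0 < a.1 := hw₀.trans_le ha
  rcases le_total a.1 ((n : ℝ) ^ (1 / 2 : ℝ)) with h | h
  · refine (measure_heavierNeighborSet_le_moment hβ₂ hw₀ hlam n hd ha).trans
      (ENNReal.ofReal_le_ofReal ?_)
    have h1 : a.1 ^ (3 - β) / n ≤ (n : ℝ) ^ ((1 - β) / 2) := by
      rw [div_le_iff₀ hn0, ← Real.rpow_add_one hn0.ne']
      calc a.1 ^ (3 - β) ≤ ((n : ℝ) ^ (1 / 2 : ℝ)) ^ (3 - β) :=
            Real.rpow_le_rpow ha0.le h (by linarith)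
        _ = _ := by
          rw [← Real.rpow_mul hn0.le]
          congr 1
          ring
    gcongr
    linarith
  · refine (measure_heavierNeighborSet_le_tail (by linarith) hw₀ n d ha).trans
      (ENNReal.ofReal_le_ofReal ?_)
    have h1 : a.1 ^ (1 - β) ≤ (n : ℝ) ^ ((1 - β) / 2) := by
      calc a.1 ^ (1 - β) ≤ ((n : ℝ) ^ (1 / 2 : ℝ)) ^ (1 - β) :=
            Real.rpow_le_rpow_of_nonpos (by positivity) h (by linarith)
        _ = _ := by
          rw [← Real.rpow_mul hn0.le]
          congr 1
          ring
    gcongr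
    linarith

/-! ### From heavier neighbours to cliques -/

/-- The clique number is at most one more than the number of heavier neighbors of some vertex. -/
theorem exists_cliqueNum_le_card_heavierNeighborSet {m d : ℕ} (lam : ℝ)
    (ω : GIRGSample (m + 1) d) :
    open Classical in
    ∃ i : Fin (m + 1), (girgGraph lam ω).cliqueNum ≤ (Finset.univ.filter fun j : Fin m =>
      (ω i, ω (i.succAbove j)) ∈ heavierNeighborSet (m + 1) d lam).card + 1 := by
  classical
  obtain ⟨s, hs⟩ := (girgGraph lam ω).exists_isNClique_cliqueNum
  rcases s.eq_empty_or_nonempty with rfl | hne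
  · refine ⟨0, ?_⟩
    rw [← hs.card_eq]
    simp
  obtain ⟨i, his, hmin⟩ := s.exists_min_image (fun u => (ω u).1) hne
  refine ⟨i, ?_⟩
  rw [← hs.card_eq]
  set N := Finset.univ.filter fun j : Fin m =>
    (ω i, ω (i.succAbove j)) ∈ heavierNeighborSet (m + 1) d lam
  have hsub : s ⊆ insert i (N.image i.succAbove) := by
    intro u hu
    rcases eq_or_ne u i with rfl | hui
    · exact Finset.mem_insert_self _ _
    obtain ⟨j, rfl⟩ := Fin.exists_succAbove_eq hui
    refine Finset.mem_insert_of_mem (Finset.mem_image_of_mem _ ?_)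
    exact Finset.mem_filter.mpr ⟨Finset.mem_univ _, hmin _ hu, (hs.isClique his hu hui.symm).2⟩
  calc s.card ≤ _ := Finset.card_le_card hsub
    _ ≤ (N.image i.succAbove).card + 1 := Finset.card_insert_le _ _
    _ ≤ N.card + 1 := by gcongr; exact Finset.card_image_le

theorem girgMeasure_cliqueNum_gt_le {β w₀ lam K : ℝ} (hβ : 1 < β) (hw₀ : 0 < w₀) (hK : 0 < K)
    {m d : ℕ} (h : ∀ a : ℝ × Torus d, w₀ ≤ a.1 →
      ((paretoMeasure w₀ (β - 1)).prod (volume : Measure (Torus d)))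
        {y | (a, y) ∈ heavierNeighborSet (m + 1) d lam} ≤
        ENNReal.ofReal (K * ((m + 1 : ℕ) : ℝ) ^ ((1 - β) / 2))) :
    girgMeasure (m + 1) β w₀ d {ω | ¬((girgGraph lam ω).cliqueNum : ℝ) ≤
        (Real.exp 1 * K + 1) * ((m + 1 : ℕ) : ℝ) ^ ((3 - β) / 2)} ≤
      ENNReal.ofReal (((m + 1 : ℕ) : ℝ) *
        Real.exp (1 - ((m + 1 : ℕ) : ℝ) ^ ((3 - β) / 2))) := by
  classical
  have := isProbabilityMeasure_paretoMeasure hw₀ (sub_pos.mpr hβ)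
  set n : ℝ := ((m + 1 : ℕ) : ℝ) with hn
  have hn0 : 0 < n := by positivity
  set ν := (paretoMeasure w₀ (β - 1)).prod (volume : Measure (Torus d))
  -- The `-1` accounts for the lightest vertex itself. The `e * K` part absorbs the Chernoff
  -- exponent, leaving one `n ^ ((3 - β) / 2)` for the decay.
  set t := (Real.exp 1 * K + 1) * n ^ ((3 - β) / 2) - 1 with ht
  have hae : ∀ᵐ a ∂ν, ν {y | (a, y) ∈ heavierNeighborSet (m + 1) d lam} ≤
      ENNReal.ofReal (K * n ^ ((1 - β) / 2)) := by
    filter_upwards [Measure.quasiMeasurePreserving_fst.ae (ae_le_paretoMeasure w₀ (β - 1))]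
      with a ha using h a ha
  have htail := fun i => measure_pi_le_card_filter_le ν
    (measurableSet_heavierNeighborSet (m + 1) d lam) (by positivity) hae m i t
  have hexp : (m : ℝ) * (Real.exp 1 * (K * n ^ ((1 - β) / 2))) - t ≤ 1 - n ^ ((3 - β) / 2) := by
    have h1 : n ^ ((3 - β) / 2) = n * n ^ ((1 - β) / 2) := by
      rw [mul_comm, ← Real.rpow_add_one hn0.ne']
      congr 1
      ring
    have h2 : (m : ℝ) ≤ n := by simp [hn]
    have h3 : (m : ℝ) * (Real.exp 1 * (K * n ^ ((1 - β) / 2))) ≤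
        n * (Real.exp 1 * (K * n ^ ((1 - β) / 2))) := by gcongr
    rw [ht, h1]
    linarith
  calc _ ≤ girgMeasure (m + 1) β w₀ d (⋃ i : Fin (m + 1),
        {ω | t ≤ (Finset.univ.filter fun j : Fin m =>
          (ω i, ω (i.succAbove j)) ∈ heavierNeighborSet (m + 1) d lam).card}) := by
        refine measure_mono fun ω hω => ?_
        obtain ⟨i, hi⟩ := exists_cliqueNum_le_card_heavierNeighborSet lam ω
        refine Set.mem_iUnion.mpr ⟨i, ?_⟩
        have hi' : ((girgGraph lam ω).cliqueNum : ℝ) ≤ (Finset.univ.filter fun j : Fin m =>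
          (ω i, ω (i.succAbove j)) ∈ heavierNeighborSet (m + 1) d lam).card + 1 := by
          exact_mod_cast hi
        simp only [Set.mem_ofPred_eq, not_le] at hω ⊢
        linarith
    _ ≤ ∑ i : Fin (m + 1), _ := measure_iUnion_fintype_le _ _
    _ ≤ ∑ _i : Fin (m + 1), ENNReal.ofReal (Real.exp (1 - n ^ ((3 - β) / 2))) :=
        Finset.sum_le_sum fun i _ => (htail i).trans
          (ENNReal.ofReal_le_ofReal (Real.exp_le_exp.mpr hexp))
    _ = _ := by
        rw [Finset.sum_const, Finset.card_univ, Fintype.card_fin, nsmul_eq_mul,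
          ENNReal.ofReal_mul hn0.le, hn, ENNReal.ofReal_natCast]

theorem tendsto_mul_exp_one_sub_rpow {γ : ℝ} (hγ : 0 < γ) :
    Tendsto (fun n : ℕ => (n : ℝ) * Real.exp (1 - (n : ℝ) ^ γ)) atTop (𝓝 0) := by
  -- With `x = n ^ γ` the claim is that `x ^ (1 / γ) * exp (-x)` tends to `0`.
  have h := ((tendsto_rpow_mul_exp_neg_mul_atTop_nhds_zero (1 / γ) 1 one_pos).comp
    ((tendsto_rpow_atTop hγ).comp tendsto_natCast_atTop_atTop)).const_mul (Real.exp 1)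
  rw [mul_zero] at h
  refine h.congr fun n => ?_
  simp only [Function.comp_apply]
  rw [← Real.rpow_mul n.cast_nonneg, mul_one_div_cancel hγ.ne', Real.rpow_one, sub_eq_add_neg,
    Real.exp_add, neg_one_mul]
  ring

theorem mainTheorem9 (β w₀ lam : ℝ) (hβ₂ : 2 < β) (hβ₃ : β < 3) (hw₀ : 0 < w₀) (hlam : 0 < lam) :
    ∃ C : ℝ, 0 < C ∧ ∀ d : ℕ → ℕ, (∀ n, 1 ≤ d n) →
      Tendsto
        (fun n : ℕ => girgMeasure n β w₀ (d n)
          {ω | ((girgGraph lam ω).cliqueNum : ℝ) ≤ C * (n : ℝ) ^ ((3 - β) / 2)})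
        atTop (𝓝 1) := by
  obtain ⟨K, hK, hKb⟩ := exists_measure_heavierNeighborSet_le hβ₂ hβ₃ hw₀ hlam
  refine ⟨Real.exp 1 * K + 1, by positivity, fun d hd => ?_⟩
  have := isProbabilityMeasure_paretoMeasure hw₀ (show 0 < β - 1 by linarith)
  have hprob : ∀ n, IsProbabilityMeasure (girgMeasure n β w₀ (d n)) := fun n => by
    unfold girgMeasure
    infer_instance
  have hlim := ENNReal.tendsto_ofReal
    (tendsto_mul_exp_one_sub_rpow (show 0 < (3 - β) / 2 by linarith))
  rw [ENNReal.ofReal_zero] at hlim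
  have hlow := ENNReal.Tendsto.sub (tendsto_const_nhds (x := (1 : ENNReal))) hlim
    (Or.inl ENNReal.one_ne_top)
  rw [tsub_zero] at hlow
  refine tendsto_of_tendsto_of_tendsto_of_le_of_le' hlow tendsto_const_nhds ?_
    (Eventually.of_forall fun n => prob_le_one)
  filter_upwards [eventually_ge_atTop 1] with n hn
  obtain ⟨m, rfl⟩ := Nat.exists_eq_add_of_le' hn
  have hbad := girgMeasure_cliqueNum_gt_le (by linarith) hw₀ hK
    fun a ha => hKb (m + 1) (d (m + 1)) hn (hd _) a ha
  refine tsub_le_iff_right.mpr (le_trans ?_ (add_le_add_right hbad _))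
  -- Subadditivity replaces the complement formula, so the clique event need not be shown
  -- measurable.
  rw [← measure_univ (μ := girgMeasure (m + 1) β w₀ (d (m + 1)))]
  refine (measure_mono fun ω _ => ?_).trans (measure_union_le _ _)
  exact em _
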